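/- All paratopological groups (groups with a topology making multiplication jointly continuous) are assumed to be $T_0$. For a paratopological group $G$, let $G^\sharp$ be its group coreflection, i.e. the same group with the topological group topology whose neighborhood base at the identity consists of the sets $V\cap V^{-1}$, $V$ a neighborhood of the identity of $G$. The Raĭkov completion $\breve G$ of $G$ is the paratopological group, unique up to topological isomorphism over $G$, that contains $G$ as a topological subgroup dense in $\breve G^\sharp$ and for which $\breve G^\sharp$ is complete in its two-sided uniformity. Let $\mathcal C$ be the class of continuous homomorphisms from sequentially compact topological groups to paratopological groups. A paratopological group $\widetilde G\supseteq G$ (with $G$ a topological subgroup) is a $\mathcal C$-semicompletion of $G$ if every homomorphism $h\colon X\to G$ in $\mathcal C$ extends uniquely to a continuous homomorphism $\breve X\to\widetilde G$; and $\mathcal C[G)$ is the smallest $\mathcal C$-semicompletion $K$ of $G$ with $G\subseteq K\subseteq\breve G$, that is, the intersection of all of them. Let $\mathbb T$ be the circle group, $e$ the identity of $\mathbb T^{\omega_1}$ and $\Sigma=\{x\in\mathbb T^{\omega_1}: |\{\alpha\in\omega_1: x_\alpha\ne 1\}|\le\omega\}$. There exist elements $c\in\mathbb T^{\omega_1}$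 of infinite order with $\langle c\rangle\cap\Sigma=\{e\}$, and for every such $c$ the following hold. 1. The sets $O_U=\bigcup_{n\ge 0}(c^nU\cap\Sigma)\times\{n\}$, where $U$ runs over the open neighborhoods of $e$ in $\mathbb T^{\omega_1}$, form a base of open neighborhoods at the identity for a Hausdorff paratopological group topology on the abelian group $G=\Sigma\times\mathbb Z$. 2. The Raĭkov completion $\breve G$ of $G$ exists, the smallest $\mathcal C$-semicompletion $\mathcal C[G)$ of $G$ in $\breve G$ exists, $\mathcal C[G)=\breve G$, and $\mathcal C[G)$ is not a $T_1$-space. 3. The subgroup $H=\Sigma\times\{0\}$ of $G$ is a sequentially compact, $\omega$-bounded topological group (the closure in $H$ of every countable subset of $H$ is compact). 4. The closure of $H$ in $G$ is $\Sigma\times\{0,-1,-2,\dots\}$, which is not a subgroup of $G$. -/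

import Mathlib

open Topology
open scoped Pointwise

universe u

/-! ### Paratopological groups, group coreflection, Raikov completion -/

/-- A paratopological group: a group with a `T₀` topology for which the multiplication is
(jointly) continuous. -/
class ParatopologicalGroup (G : Type*) [Group G] [TopologicalSpace G] : Prop
    extends ContinuousMul G, T0Space G

/-- The underlying group of the group coreflection of `G`; it carries a different topology. -/
def Sharp (G : Type*) : Type _ := G

namespace Sharp

instance instGroup {G : Type*} [Group G] : Group (Sharp G) := inferInstanceAs (Group G)

/-- The identity map from `G` to its group coreflection. -/
def of {G : Type*} [Group G] : G ≃* Sharp G := MulEquiv.refl G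

/-- The topology of the group coreflection: the coarsest topology that contains the topology of
`G` and all the sets `U⁻¹` with `U` open in `G`. -/
instance instTopologicalSpace {G : Type*} [Group G] [t : TopologicalSpace G] :
    TopologicalSpace (Sharp G) :=
  t.induced (fun x : Sharp G => of.symm x) ⊓ t.induced (fun x : Sharp G => of.symm x⁻¹)

theorem continuous_iff {G Z : Type*} [Group G] [t : TopologicalSpace G] [tZ : TopologicalSpace Z]
    {f : Z → Sharp G} :
    Continuous f ↔
      Continuous (fun z => of.symm (f z)) ∧ Continuous (fun z => of.symm (f z)⁻¹) := by
  have h1 := @continuous_inf_rng Z (Sharp G) f tZ (t.induced (fun x : Sharp G => of.symm x))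
    (t.induced (fun x : Sharp G => of.symm x⁻¹))
  have h2 := (continuous_induced_rng (t₁ := tZ) (t₂ := t) (f := fun x : Sharp G => of.symm x) (g := f))
  have h3 := (continuous_induced_rng (t₁ := tZ) (t₂ := t) (f := fun x : Sharp G => of.symm x⁻¹) (g := f))
  exact h1.trans (and_congr h2 h3)

instance instIsTopologicalGroup {G : Type*} [Group G] [TopologicalSpace G] [ContinuousMul G] :
    IsTopologicalGroup (Sharp G) := by
  obtain ⟨h1, h2⟩ := continuous_iff.1 (continuous_id (X := Sharp G))
  have h1' : Continuous (fun x : Sharp G => (of.symm x : G)) := h1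
  have h2' : Continuous (fun x : Sharp G => (of.symm x⁻¹ : G)) := h2
  refine { continuous_mul := continuous_iff.2 ⟨?_, ?_⟩
           continuous_inv := continuous_iff.2 ⟨h2', ?_⟩ }
  · simp only [map_mul]
    exact (h1'.comp continuous_fst).mul (h1'.comp continuous_snd)
  · simp only [mul_inv_rev, map_mul]
    exact (h2'.comp continuous_snd).mul (h2'.comp continuous_fst)
  · simpa only [inv_inv] using h1'

end Sharp

/-- The two-sided uniformity of a topological group. -/
@[reducible]
def twoSidedUniformSpace (G : Type*) [Group G] [TopologicalSpace G] [IsTopologicalGroup G] :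
    UniformSpace G :=
  IsTopologicalGroup.leftUniformSpace G ⊓ IsTopologicalGroup.rightUniformSpace G

/-- A topological group is Raikov complete if it is complete in its two-sided uniformity. -/
def RaikovComplete (G : Type*) [Group G] [TopologicalSpace G] [IsTopologicalGroup G] : Prop :=
  @CompleteSpace G (twoSidedUniformSpace G)

/-- `G` is `♯`-complete if its group coreflection is Raikov complete. -/
def SharpComplete (G : Type*) [Group G] [TopologicalSpace G] [ContinuousMul G] : Prop :=
  RaikovComplete (Sharp G)

/-- The paratopological group `B`, with the embedding `i` of `G`, is a Raikov completion of `G`: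
it is `♯`-complete and `i` is a topological isomorphism of `G` onto a `♯`-dense subgroup of `B`.
These properties determine `(B, i)` up to a unique topological isomorphism over `G`. -/
structure IsRaikovCompletion {G B : Type*} [Group G] [TopologicalSpace G] [Group B]
    [TopologicalSpace B] [ParatopologicalGroup B] (i : G →* B) : Prop where
  isEmbedding : IsEmbedding i
  sharpDense : DenseRange (fun g : G => Sharp.of (i g))
  sharpComplete : SharpComplete B

/-! ### Semicompletions -/

/-- A class of continuous homomorphisms between (paratopological) groups. -/
def HomClass : Type (u + 1) :=
  ∀ ⦃X Y : Type u⦄ [Group X] [TopologicalSpace X] [Group Y] [TopologicalSpace Y],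
    (X →ₜ* Y) → Prop

/-- The class of the continuous homomorphisms from sequentially compact topological groups to
paratopological groups (both satisfying `T₀`). -/
def seqCompactHoms : HomClass.{u} :=
  fun X Y _ _ _ _ _ =>
    IsTopologicalGroup X ∧ T0Space X ∧ SeqCompactSpace X ∧ ParatopologicalGroup Y

/-- The group `S`, with the embedding `j` of `G`, is a `C`-semicompletion of `G`: `S` is a
paratopological group containing `G` as a topological subgroup, and every homomorphism
`h : X → G` in the class `C` has a unique extension to a continuous homomorphism from the Raikov
completion of `X` to `S`. -/
structure IsSemicompletion (C : HomClass.{u}) {G S : Type u} [Group G] [TopologicalSpace G]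
    [Group S] [TopologicalSpace S] (j : G →* S) : Prop where
  paratopologicalGroup : ParatopologicalGroup S
  isEmbedding : IsEmbedding j
  existsUnique_extension : ∀ (X : Type u) [Group X] [TopologicalSpace X] [ParatopologicalGroup X]
    (h : X →ₜ* G), C h →
    ∀ (B : Type u) [Group B] [TopologicalSpace B] [ParatopologicalGroup B] (k : X →* B),
      IsRaikovCompletion k → ∃! f : B →ₜ* S, ∀ x : X, f (k x) = j (h x)

/-- The subgroups `K` of `B` that contain (the image under `i` of) `G` and are
`C`-semicompletions of `G`. -/
def semicompletionsIn (C : HomClass.{u}) {G B : Type u} [Group G] [TopologicalSpace G]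
    [Group B] [TopologicalSpace B] (i : G →* B) : Set (Subgroup B) :=
  {K | ∃ hK : ∀ g : G, i g ∈ K, IsSemicompletion C (i.codRestrict K hK)}

/-- The `C`-semicompletion of `G`, as a subgroup of the Raikov completion `i : G →* B` of `G`:
the intersection of all intermediate groups that are `C`-semicompletions of `G`. -/
def semicompletion (C : HomClass.{u}) {G B : Type u} [Group G] [TopologicalSpace G]
    [Group B] [TopologicalSpace B] (i : G →* B) : Subgroup B :=
  sInf (semicompletionsIn C i)

/-- A space is `ω`-bounded if the closure of every countable subset is compact. -/
def OmegaBounded (X : Type*) [TopologicalSpace X] : Prop :=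
  ∀ s : Set X, s.Countable → IsCompact (closure s)

/-! ### The group `Σ × ℤ` -/

/-- The compact group `𝕋^{ω₁}` with the product topology. -/
abbrev TorusPower : Type u := (Ordinal.omega.{u} 1).ToType → Circle

/-- The `Σ`-product in `𝕋^{ω₁}`: the elements with at most countably many coordinates
different from `1`. -/
def sigmaProduct : Subgroup TorusPower.{u} where
  carrier := {x | {a | x a ≠ 1}.Countable}
  one_mem' := by simp
  mul_mem' := by
    intro x y hx hy
    refine (hx.union hy).mono ?_
    intro a ha
    by_contra hcon
    simp only [Set.mem_union, Set.mem_ofPred_eq, not_or, not_not] at hcon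
    exact ha (by simp [hcon.1, hcon.2])
  inv_mem' := by
    intro x hx
    simpa using hx

/-- The group `Σ × ℤ` (with `ℤ` written multiplicatively), whose topology depends on a
parameter `c ∈ 𝕋^{ω₁}`. -/
def SigmaZ (_c : TorusPower.{u}) : Type u := sigmaProduct.{u} × Multiplicative ℤ

namespace SigmaZ

noncomputable instance instCommGroup (c : TorusPower.{u}) : CommGroup (SigmaZ c) :=
  inferInstanceAs (CommGroup (sigmaProduct.{u} × Multiplicative ℤ))

variable {c : TorusPower.{u}}

/-- The component of `g ∈ Σ × ℤ` in `Σ`, as an element of `𝕋^{ω₁}`. -/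
def torusPart (g : SigmaZ c) : TorusPower.{u} := (Prod.fst g : sigmaProduct.{u})

/-- The component of `g ∈ Σ × ℤ` in `ℤ`. -/
def intPart (g : SigmaZ c) : ℤ := Multiplicative.toAdd (Prod.snd g)

/-- The set `O_U`, the union over `n ∈ {0, 1, 2, …}` of the sets `(cⁿU ∩ Σ) × {n}`. -/
def basicNhd (c : TorusPower.{u}) (U : Set TorusPower.{u}) : Set (SigmaZ c) :=
  {g | ∃ n : ℕ, g.torusPart ∈ c ^ n • U ∧ g.intPart = n}

theorem basicNhd_mono {U V : Set TorusPower.{u}} (h : U ⊆ V) : basicNhd c U ⊆ basicNhd c V :=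
  fun _ ⟨n, hn, hk⟩ => ⟨n, Set.smul_set_mono h hn, hk⟩

/-- The topology of `Σ × ℤ`: a set `s` is open if with each of its points `g` it contains
`g * O_U` for some open neighbourhood `U` of the identity of `𝕋^{ω₁}`. -/
instance instTopologicalSpace : TopologicalSpace (SigmaZ c) where
  IsOpen s := ∀ g ∈ s, ∃ U : Set TorusPower.{u}, IsOpen U ∧ 1 ∈ U ∧ g • basicNhd c U ⊆ s
  isOpen_univ := fun _ _ => ⟨Set.univ, isOpen_univ, Set.mem_univ _, Set.subset_univ _⟩
  isOpen_inter := by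
    rintro s t hs ht g ⟨hgs, hgt⟩
    obtain ⟨U, hU, h1U, hUs⟩ := hs g hgs
    obtain ⟨V, hV, h1V, hVt⟩ := ht g hgt
    exact ⟨U ∩ V, hU.inter hV, ⟨h1U, h1V⟩, Set.subset_inter
      ((Set.smul_set_mono (basicNhd_mono Set.inter_subset_left)).trans hUs)
      ((Set.smul_set_mono (basicNhd_mono Set.inter_subset_right)).trans hVt)⟩
  isOpen_sUnion := by
    rintro S hS g ⟨s, hsS, hgs⟩
    obtain ⟨U, hU, h1U, hUs⟩ := hS s hsS g hgs
    exact ⟨U, hU, h1U, hUs.trans (Set.subset_sUnion_of_mem hsS)⟩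

/-- The subgroup `Σ × {0}` of `Σ × ℤ`. -/
def sigmaSubgroup (c : TorusPower.{u}) : Subgroup (SigmaZ c) where
  carrier := {g | g.intPart = 0}
  one_mem' := rfl
  mul_mem' := by
    intro x y hx hy
    change x.intPart + y.intPart = 0
    rw [Set.mem_ofPred_eq] at hx hy
    rw [hx, hy, add_zero]
  inv_mem' := by
    intro x hx
    change -x.intPart = 0
    rw [Set.mem_ofPred_eq] at hx
    rw [hx, neg_zero]

end SigmaZ

/-!
The shear `(x, n) ↦ (x c⁻ⁿ, n)` turns the sets `O_U` into the traces of the sets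
`U × {0, 1, 2, …}`. It therefore embeds `Σ × ℤ` in `𝕋^{ω₁} × ℤ`, where `ℤ` carries the topology of
the upper sets, which is not `T₁`. The coreflection of this product is the product of a compact
and a discrete group, hence complete, and the image is dense in it because `Σ` is dense in
`𝕋^{ω₁}`: the product is the Raikov completion. By the choice of `c` the first coordinate
`x c⁻ⁿ` alone is injective, which makes the topology Hausdorff.

The group `Σ` is sequentially compact and its Raikov completion is `𝕋^{ω₁}`, so every
semicompletion of `Σ × ℤ` in the product contains `𝕋^{ω₁} × {0}`; together with the image of
`Σ × ℤ` this generates everything.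
-/

open Filter

/-! ### The two-sided uniformity -/

section TwoSidedUniformity

variable {G H : Type*} [Group G] [TopologicalSpace G] [IsTopologicalGroup G]
  [Group H] [TopologicalSpace H] [IsTopologicalGroup H]

variable (G) in
theorem toTopologicalSpace_twoSidedUniformSpace :
    (twoSidedUniformSpace G).toTopologicalSpace = ‹TopologicalSpace G› := by
  rw [twoSidedUniformSpace, UniformSpace.toTopologicalSpace_inf]
  exact inf_idem _

theorem uniformContinuous_twoSidedUniformSpace {f : G →* H} (hf : Continuous f) :
    @UniformContinuous G H (twoSidedUniformSpace G) (twoSidedUniformSpace H) f := by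
  have hf1 : Tendsto f (𝓝 1) (𝓝 1) := map_one f ▸ hf.tendsto 1
  refine UniformContinuous.inf_rng (UniformContinuous.inf_dom_left ?_)
    (UniformContinuous.inf_dom_right ?_)
  · exact tendsto_comap_iff.2 ((hf1.comp tendsto_comap).congr fun _ => by simp)
  · exact tendsto_comap_iff.2 ((hf1.comp tendsto_comap).congr fun _ => by simp)

theorem comap_twoSidedUniformSpace {f : G →* H} (hf : IsInducing f) :
    (twoSidedUniformSpace H).comap f = twoSidedUniformSpace G := by
  have hf1 : 𝓝 (1 : G) = comap f (𝓝 1) := by rw [hf.nhds_eq_comap, map_one]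
  rw [UniformSpace.comap_inf]
  congr 1
  · refine UniformSpace.ext (comap_comap.trans ?_)
    rw [uniformity_eq_comap_nhds_one_left, hf1, comap_comap]
    exact congrArg (comap · _) (funext fun _ => by simp)
  · refine UniformSpace.ext (comap_comap.trans ?_)
    rw [uniformity_eq_comap_nhds_one', hf1, comap_comap]
    exact congrArg (comap · _) (funext fun _ => by simp)

theorem cauchy_nhds_twoSidedUniformSpace (x : G) : @Cauchy G (twoSidedUniformSpace G) (𝓝 x) := by
  have h := @cauchy_nhds G (twoSidedUniformSpace G) x
  rwa [toTopologicalSpace_twoSidedUniformSpace] at h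

namespace RaikovComplete

theorem of_weaklyLocallyCompactSpace [WeaklyLocallyCompactSpace G] : RaikovComplete G := by
  refine @CompleteSpace.mk G (twoSidedUniformSpace G) fun {F} hF => ?_
  rw [toTopologicalSpace_twoSidedUniformSpace]
  let := IsTopologicalGroup.rightUniformSpace G
  have : IsRightUniformGroup G := { uniformity_eq := rfl }
  have : CompleteSpace G := IsRightUniformGroup.completeSpace_of_weaklyLocallyCompactSpace
  exact CompleteSpace.complete (hF.mono_uniformSpace inf_le_right)

theorem exists_le_nhds (hG : RaikovComplete G) {F : Filter G}
    (hF : @Cauchy G (twoSidedUniformSpace G) F) : ∃ x, F ≤ 𝓝 x := by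
  obtain ⟨x, hx⟩ := @CompleteSpace.complete G (twoSidedUniformSpace G) hG F hF
  rw [toTopologicalSpace_twoSidedUniformSpace] at hx
  exact ⟨x, hx⟩

theorem exists_extension [T0Space H] (hH : RaikovComplete H) {X : Type*} [Group X]
    [TopologicalSpace X] {k : X →* G} (hk : IsDenseInducing k) {φ : X →* H} (hφ : Continuous φ) :
    ∃ f : G →ₜ* H, ∀ x, f (k x) = φ x := by
  have : IsTopologicalGroup X := hk.isInducing.topologicalGroup k
  have hlim (y : G) : ∃ z, Tendsto φ (comap k (𝓝 y)) (𝓝 z) := by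
    have : (comap k (𝓝 y)).NeBot := hk.comap_nhds_neBot y
    have hcauchy : @Cauchy X (twoSidedUniformSpace X) (comap k (𝓝 y)) := by
      rw [← comap_twoSidedUniformSpace hk.isInducing]
      exact @Cauchy.comap' _ _ ((twoSidedUniformSpace G).comap k) (twoSidedUniformSpace G) _ _
        (cauchy_nhds_twoSidedUniformSpace y) le_rfl this
    exact hH.exists_le_nhds (@Cauchy.map _ _ (twoSidedUniformSpace X) (twoSidedUniformSpace H)
      _ _ hcauchy (uniformContinuous_twoSidedUniformSpace hφ))
  have hcont : Continuous (hk.extend φ) := hk.continuous_extend hlim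
  have hext : ∀ x, hk.extend φ (k x) = φ x := hk.extend_eq hφ
  have hmul (a b : G) : hk.extend φ (a * b) = hk.extend φ a * hk.extend φ b := by
    refine hk.dense.induction_on₂ (p := fun a b =>
      hk.extend φ (a * b) = hk.extend φ a * hk.extend φ b) ?_ ?_ a b
    · exact isClosed_eq (hcont.comp continuous_mul)
        ((hcont.comp continuous_fst).mul (hcont.comp continuous_snd))
    · intro x y
      rw [← map_mul, hext, hext, hext, map_mul]
  exact ⟨⟨MonoidHom.mk' (hk.extend φ) hmul, hcont⟩, hext⟩

end RaikovComplete

end TwoSidedUniformity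

/-! ### Paratopological groups and their coreflections -/

section ParatopologicalGroup

variable {G H : Type*} [Group G] [TopologicalSpace G] [Group H] [TopologicalSpace H]

instance [IsTopologicalGroup G] [T0Space G] : ParatopologicalGroup G where

instance [ParatopologicalGroup G] [ParatopologicalGroup H] : ParatopologicalGroup (G × H) where

instance [ParatopologicalGroup G] (K : Subgroup G) : ParatopologicalGroup K where
  continuous_mul := K.toSubmonoid.continuousMul.continuous_mul

theorem ParatopologicalGroup.of_isEmbedding [ParatopologicalGroup H] {f : G →* H}
    (hf : IsEmbedding f) : ParatopologicalGroup G where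
  toContinuousMul := hf.isInducing.continuousMul f
  t0 := hf.t0Space.t0

theorem ParatopologicalGroup.of_isUpperSet [PartialOrder G] [MulLeftMono G] [MulRightMono G]
    [Topology.IsUpperSet G] : ParatopologicalGroup G where
  continuous_mul := continuous_iff_continuousAt.2 fun ⟨a, b⟩ => by
    simp only [ContinuousAt, nhds_prod_eq, IsUpperSet.nhds_eq_principal_Ici,
      prod_principal_principal, tendsto_principal_principal]
    exact fun _ hq => mul_le_mul' hq.1 hq.2
  t0 _ _ h := le_antisymm (IsUpperSet.specializes_iff_le.1 h.specializes')
    (IsUpperSet.specializes_iff_le.1 h.specializes)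

theorem map_mul_left_nhds_one_of_continuousMul [ContinuousMul G] (g : G) :
    map (g * ·) (𝓝 1) = 𝓝 g := by
  simpa using (Homeomorph.mulLeft g).map_nhds_eq 1

theorem hasBasis_nhds_smul [ContinuousMul G] {κ : Sort*} {p : κ → Prop} {U : κ → Set G}
    (h : (𝓝 (1 : G)).HasBasis p U) (g : G) : (𝓝 g).HasBasis p fun j => g • U j :=
  map_mul_left_nhds_one_of_continuousMul g ▸ h.map (g * ·)

theorem continuous_of_tendsto_one [ContinuousMul G] [ContinuousMul H] {f : G →* H}
    (hf : Tendsto f (𝓝 1) (𝓝 1)) : Continuous f :=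
  continuous_iff_continuousAt.2 fun g => by
    simpa only [ContinuousAt, ← map_mul_left_nhds_one_of_continuousMul g, tendsto_map'_iff,
      Function.comp_def, map_mul, mul_one] using hf.const_mul (f g)

namespace Sharp

theorem continuous_of_symm : Continuous (of.symm : Sharp G → G) :=
  (continuous_iff.1 continuous_id).1

theorem continuous_of_symm_inv : Continuous fun x : Sharp G => of.symm x⁻¹ :=
  (continuous_iff.1 continuous_id).2

/-- The homomorphism between the group coreflections induced by a homomorphism. -/
def map (f : G →* H) : Sharp G →* Sharp H :=
  (of.toMonoidHom.comp f).comp of.symm.toMonoidHom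

theorem continuous_map {f : G →* H} (hf : Continuous f) : Continuous (map f) := by
  refine continuous_iff.2 ⟨hf.comp continuous_of_symm, ?_⟩
  exact (hf.comp continuous_of_symm_inv).congr fun x => _root_.map_inv f _

theorem isInducing_map {f : G →* H} (hf : IsInducing f) : IsInducing (map f) := by
  constructor
  unfold instTopologicalSpace
  rw [induced_inf, induced_compose, induced_compose, hf.eq_induced, induced_compose,
    induced_compose]
  congr 2
  exact funext fun x => _root_.map_inv f _

instance instT0Space [T0Space G] : T0Space (Sharp G) :=
  t0Space_of_injective_of_continuous of.symm.injective continuous_of_symm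

/-- A group with continuous inversion is its own coreflection. -/
def continuousMulEquiv (G : Type*) [Group G] [TopologicalSpace G] [ContinuousInv G] :
    G ≃ₜ* Sharp G where
  toMulEquiv := of
  continuous_toFun := continuous_iff.2 ⟨continuous_id, continuous_inv (G := G)⟩
  continuous_invFun := continuous_of_symm

/-- The coreflection of a product is the product of the coreflections. -/
def prodHomeomorph (G H : Type*) [Group G] [TopologicalSpace G] [Group H] [TopologicalSpace H] :
    Sharp (G × H) ≃ₜ Sharp G × Sharp H where
  toFun p := (of (of.symm p).1, of (of.symm p).2)
  invFun p := of (of.symm p.1, of.symm p.2)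
  left_inv _ := rfl
  right_inv _ := rfl
  continuous_toFun := (continuous_map (f := MonoidHom.fst G H) continuous_fst).prodMk
    (continuous_map (f := MonoidHom.snd G H) continuous_snd)
  continuous_invFun := continuous_iff.2
    ⟨continuous_of_symm.prodMap continuous_of_symm,
      continuous_of_symm_inv.prodMap continuous_of_symm_inv⟩

theorem discreteTopology_of_isUpperSet [PartialOrder G] [MulLeftMono G] [MulRightMono G]
    [Topology.IsUpperSet G] : DiscreteTopology (Sharp G) := by
  have : ParatopologicalGroup G := .of_isUpperSet
  have hIci : IsOpen (of.symm ⁻¹' Set.Ici (1 : G) : Set (Sharp G)) :=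
    (IsUpperSet.isOpen_iff_isUpperSet.2 (isUpperSet_Ici _)).preimage continuous_of_symm
  refine discreteTopology_of_isOpen_singleton_one ?_
  convert hIci.inter hIci.inv
  refine Eq.symm (Set.eq_singleton_iff_unique_mem.2 ⟨?_, fun x ⟨hx, hx'⟩ => ?_⟩)
  · exact ⟨le_rfl, inv_one (G := G).ge⟩
  · have h1 : (1 : G) ≤ of.symm x := hx
    have h2 : of.symm x ≤ (1 : G) := one_le_inv'.1 (show (1 : G) ≤ (of.symm x)⁻¹ from hx')
    exact le_antisymm (α := G) h2 h1

end Sharp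
end ParatopologicalGroup

/-! ### The universal property of Raikov completions -/

namespace IsRaikovCompletion

variable {G B Z : Type*} [Group G] [TopologicalSpace G] [Group B] [TopologicalSpace B]
  [ParatopologicalGroup B] [Group Z] [TopologicalSpace Z] [ParatopologicalGroup Z] {i : G →* B}

theorem isDenseInducing_map (hi : IsRaikovCompletion i) : IsDenseInducing (Sharp.map i) :=
  ⟨Sharp.isInducing_map hi.isEmbedding.isInducing, hi.sharpDense⟩

theorem ext (hi : IsRaikovCompletion i) {f g : B →ₜ* Z} (h : ∀ x, f (i x) = g (i x)) :
    f = g := by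
  have heq := hi.isDenseInducing_map.dense.equalizer (Sharp.continuous_map f.continuous_toFun)
    (Sharp.continuous_map g.continuous_toFun) (funext h)
  exact ContinuousMonoidHom.ext (congrFun heq)

theorem continuous_of_continuous_map (hi : IsRaikovCompletion i) {f : B →* Z}
    (hf : Continuous (Sharp.map f)) (hfi : Continuous (f.comp i)) : Continuous f := by
  refine continuous_of_tendsto_one fun V hV => ?_
  obtain ⟨W, hWo, hW1, hWV⟩ := exists_open_nhds_one_mul_subset hV
  have hcomap : (f.comp i) ⁻¹' W ∈ comap i (𝓝 1) := by
    rw [← map_one i, ← hi.isEmbedding.nhds_eq_comap]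
    exact hfi.continuousAt (hWo.mem_nhds (by rwa [map_one]))
  obtain ⟨O', hO', hOW⟩ := hcomap
  obtain ⟨O, hOO', hO, h1O⟩ := mem_nhds_iff.1 hO'
  refine mem_map.2 (mem_of_superset (hO.mem_nhds h1O) fun b hb => ?_)
  -- Write `b = (b g⁻¹) g` with `g ∈ O` in the dense subgroup and `b g⁻¹` small in `Sharp B`.
  obtain ⟨g, hgO, hgW⟩ : ∃ g, i g ∈ O ∧ f (b * (i g)⁻¹) ∈ W := by
    have hopen : IsOpen {y : Sharp B | Sharp.of.symm y ∈ O ∧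
        Sharp.of.symm (Sharp.map f (Sharp.of b * y⁻¹)) ∈ W} :=
      (hO.preimage Sharp.continuous_of_symm).inter <| hWo.preimage <|
        Sharp.continuous_of_symm.comp (hf.comp (continuous_const.mul continuous_inv))
    exact hi.sharpDense.exists_mem_open hopen
      ⟨Sharp.of b, hb, by rwa [mul_inv_cancel, map_one]⟩
  have hfb : f b = f (b * (i g)⁻¹) * f (i g) := by rw [← map_mul, inv_mul_cancel_right]
  exact hWV (hfb ▸ Set.mul_mem_mul hgW (hOW (hOO' hgO)))

theorem existsUnique_extension (hi : IsRaikovCompletion i) (hZ : SharpComplete Z) {φ : G →* Z}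
    (hφ : Continuous φ) : ∃! f : B →ₜ* Z, ∀ g, f (i g) = φ g := by
  obtain ⟨f, hf⟩ := RaikovComplete.exists_extension hZ hi.isDenseInducing_map
    (Sharp.continuous_map hφ)
  let f' : B →* Z := (Sharp.of.symm.toMonoidHom.comp f.toMonoidHom).comp Sharp.of.toMonoidHom
  have hf' : f'.comp i = φ := MonoidHom.ext hf
  have hcont : Continuous f' :=
    hi.continuous_of_continuous_map (f := f') f.continuous_toFun (hf' ▸ hφ)
  exact ⟨⟨f', hcont⟩, hf, fun g hg => hi.ext fun x => (hg x).trans (hf x).symm⟩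

theorem exists_isomorphism (hi : IsRaikovCompletion i) {j : G →* Z} (hj : IsRaikovCompletion j) :
    ∃ e : B ≃ₜ* Z, ∀ g, e (i g) = j g := by
  obtain ⟨f, hf, -⟩ := hi.existsUnique_extension hj.sharpComplete hj.isEmbedding.continuous
  obtain ⟨g, hg, -⟩ := hj.existsUnique_extension hi.sharpComplete hi.isEmbedding.continuous
  have hgf : g.comp f = ContinuousMonoidHom.id B :=
    hi.ext fun x => (congrArg g (hf x)).trans (hg x)
  have hfg : f.comp g = ContinuousMonoidHom.id Z :=
    hj.ext fun x => (congrArg f (hg x)).trans (hf x)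
  exact ⟨{ f with
    invFun := g
    left_inv := DFunLike.congr_fun hgf
    right_inv := DFunLike.congr_fun hfg
    continuous_invFun := g.continuous_toFun }, hf⟩

end IsRaikovCompletion

section Semicompletions

variable {C : HomClass.{u}} {G B : Type u} [Group G] [TopologicalSpace G] [Group B]
  [TopologicalSpace B] [ParatopologicalGroup B] {i : G →* B}

theorem top_mem_semicompletionsIn (hi : IsRaikovCompletion i) : ⊤ ∈ semicompletionsIn C i := by
  refine ⟨fun _ => Subgroup.mem_top _, inferInstance, hi.isEmbedding.codRestrict _ _, ?_⟩
  intro X _ _ _ h _ Y _ _ _ k hk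
  obtain ⟨f, hf, -⟩ := hk.existsUnique_extension hi.sharpComplete
    (φ := i.comp h.toMonoidHom) (hi.isEmbedding.continuous.comp h.continuous_toFun)
  let f' : Y →ₜ* (⊤ : Subgroup B) := ⟨f.toMonoidHom.codRestrict ⊤ fun _ => Subgroup.mem_top _,
    f.continuous_toFun.subtype_mk _⟩
  have hf' (x : X) : f' (k x) = i.codRestrict ⊤ (fun _ => Subgroup.mem_top _) (h x) :=
    Subtype.ext (hf x)
  exact ⟨f', hf', fun g hg => hk.ext fun x => (hg x).trans (hf' x).symm⟩

theorem range_le_of_mem_semicompletionsIn {K : Subgroup B} (hK : K ∈ semicompletionsIn C i)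
    {X Y : Type u} [Group X] [TopologicalSpace X] [ParatopologicalGroup X] [Group Y]
    [TopologicalSpace Y] [ParatopologicalGroup Y] {k : X →* Y} (hk : IsRaikovCompletion k)
    {h : X →ₜ* G} (hh : C h) {F : Y →ₜ* B} (hF : ∀ x, F (k x) = i (h x)) :
    F.toMonoidHom.range ≤ K := by
  obtain ⟨hiK, hsemi⟩ := hK
  obtain ⟨f, hf, -⟩ := hsemi.existsUnique_extension X h hh Y k hk
  let f' : Y →ₜ* B := ⟨K.subtype.comp f.toMonoidHom,
    continuous_subtype_val.comp f.continuous_toFun⟩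
  have hF' : F = f' := hk.ext fun x => (hF x).trans (congrArg Subtype.val (hf x)).symm
  rintro _ ⟨y, rfl⟩
  exact hF' ▸ (f y).2

end Semicompletions

/-! ### Σ-products -/

section SigmaSet

variable {ι : Type*} {X : ι → Type*} {p : ∀ i, X i}

/-- The `Σ`-product of the family `X` with base point `p`: the families that differ from `p` in at
most countably many coordinates. The subgroup `sigmaProduct` is the case of base point `1`. -/
def sigmaSet (p : ∀ i, X i) : Set (∀ i, X i) :=
  {x | {i | x i ≠ p i}.Countable}

variable [∀ i, TopologicalSpace (X i)]

theorem dense_sigmaSet (p : ∀ i, X i) : Dense (sigmaSet p) := by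
  classical
  intro x
  have hlim : Tendsto (fun F : Finset ι => F.piecewise x p) atTop (𝓝 x) := by
    refine tendsto_pi_nhds.2 fun i => tendsto_const_nhds.congr' ?_
    filter_upwards [eventually_ge_atTop {i}] with F hF
    exact (F.piecewise_eq_of_mem x p (Finset.singleton_subset_iff.1 hF)).symm
  refine mem_closure_of_tendsto hlim (Eventually.of_forall fun F => ?_)
  refine F.countable_toSet.mono fun i hi => ?_
  by_contra hiF
  exact hi (F.piecewise_eq_of_notMem x p hiF)

theorem exists_countable_continuous_subset_range {s : Set (∀ i, X i)} (hs : s.Countable)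
    (hsp : s ⊆ sigmaSet p) :
    ∃ (A : Set ι) (f : (∀ i : A, X i) → ∀ i, X i),
      A.Countable ∧ Continuous f ∧ s ⊆ Set.range f ∧ Set.range f ⊆ sigmaSet p := by
  classical
  -- The points that agree with `p` off a countable set `A` form a copy of `∏ i ∈ A, X i`.
  let A : Set ι := ⋃ x ∈ s, {i | x i ≠ p i}
  have hA : A.Countable := hs.biUnion hsp
  let extend (y : ∀ i : A, X i) : ∀ i, X i :=
    (Homeomorph.piEquivPiSubtypeProd (· ∈ A) X).symm (y, fun i => p i)
  have hcont : Continuous extend :=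
    (Homeomorph.continuous_symm _).comp (continuous_id.prodMk continuous_const)
  refine ⟨A, extend, hA, hcont, fun x hx => ?_, ?_⟩
  · refine ⟨fun i => x i, funext fun i => ?_⟩
    by_cases hi : i ∈ A
    · exact dif_pos hi
    · refine (dif_neg hi).trans (not_not.1 fun hne => hi ?_)
      exact Set.mem_biUnion hx (Ne.symm hne)
  · rintro _ ⟨y, rfl⟩
    exact hA.mono fun i hi => by_contra fun hiA => hi (dif_neg hiA)

variable [∀ i, CompactSpace (X i)]

theorem isSeqCompact_sigmaSet [∀ i, FirstCountableTopology (X i)] (p : ∀ i, X i) :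
    IsSeqCompact (sigmaSet p) := fun x hx => by
  obtain ⟨A, f, hA, hf, hxf, hfp⟩ :=
    exists_countable_continuous_subset_range (Set.countable_range x) (Set.range_subset_iff.2 hx)
  have : Countable A := hA.to_subtype
  obtain ⟨a, ha, hlim⟩ := IsSeqCompact.range hf.seqContinuous fun n => hxf (Set.mem_range_self n)
  exact ⟨a, hfp ha, hlim⟩

theorem omegaBounded_sigmaSet [∀ i, R1Space (X i)] (p : ∀ i, X i) :
    OmegaBounded (sigmaSet p) := fun s hs => by
  obtain ⟨A, f, -, hf, hsf, hfp⟩ := exists_countable_continuous_subset_range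
    (hs.image Subtype.val) (Subtype.coe_image_subset _ s)
  have hcompact : IsCompact (Subtype.val ⁻¹' Set.range f : Set (sigmaSet p)) :=
    IsInducing.subtypeVal.isCompact_preimage_iff (by rwa [Subtype.range_coe]) |>.2
      (isCompact_range hf)
  exact hcompact.closure_of_subset (Set.image_subset_iff.1 hsf)

end SigmaSet

theorem OmegaBounded.of_homeomorph {X Y : Type*} [TopologicalSpace X] [TopologicalSpace Y]
    (hX : OmegaBounded X) (e : X ≃ₜ Y) : OmegaBounded Y := fun s hs => by
  rw [← e.isCompact_preimage, e.preimage_closure]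
  exact hX _ (hs.preimage e.injective)

instance seqCompactSpace_sigmaProduct : SeqCompactSpace sigmaProduct.{u} :=
  isSeqCompact_iff_seqCompactSpace.1 (isSeqCompact_sigmaSet 1)

theorem omegaBounded_sigmaProduct : OmegaBounded sigmaProduct.{u} :=
  omegaBounded_sigmaSet 1

theorem dense_sigmaProduct : Dense (sigmaProduct.{u} : Set TorusPower.{u}) :=
  dense_sigmaSet 1

theorem isRaikovCompletion_subtype_sigmaProduct :
    IsRaikovCompletion sigmaProduct.{u}.subtype where
  isEmbedding := .subtypeVal
  sharpDense := (Sharp.continuousMulEquiv TorusPower.{u}).surjective.denseRange.comp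
    dense_sigmaProduct.denseRange_val (Sharp.continuousMulEquiv _).continuous_toFun
  sharpComplete := by
    have := (Sharp.continuousMulEquiv TorusPower.{u}).toHomeomorph.compactSpace
    exact .of_weaklyLocallyCompactSpace

theorem not_isOfFinOrder_circleExp_one : ¬ IsOfFinOrder (Circle.exp 1) := by
  rw [isOfFinOrder_iff_zpow_eq_one]
  rintro ⟨n, hn, hexp⟩
  rw [← Circle.exp_zsmul, ← Circle.exp_zero, Circle.exp_eq_exp] at hexp
  obtain ⟨m, hm⟩ := hexp
  have hm' : (n : ℝ) = (m * 2 : ℤ) * Real.pi := by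
    push_cast
    linear_combination (by simpa using hm : (n : ℝ) = m * (2 * Real.pi))
  have hm0 : m * 2 ≠ 0 := by
    intro h0
    rw [h0] at hm'
    exact hn (by simpa using hm')
  exact (irrational_pi.intCast_mul hm0).ne_int n hm'.symm

instance uncountable_toType_omega_one : Uncountable (Ordinal.omega.{u} 1).ToType := by
  rw [← Cardinal.aleph0_lt_mk_iff, Cardinal.mk_toType, Ordinal.card_omega]
  exact Cardinal.aleph0_lt_aleph_one

theorem zpowers_const_inf_sigmaProduct_eq_bot {a : Circle} (ha : ¬ IsOfFinOrder a) :
    Subgroup.zpowers (fun _ => a : TorusPower.{u}) ⊓ sigmaProduct.{u} = ⊥ := by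
  refine (Subgroup.eq_bot_iff_forall _).2 ?_
  rintro _ ⟨⟨n, rfl⟩, hn⟩
  obtain rfl : n = 0 := by
    by_contra hn0
    refine Set.not_countable_univ (hn.mono fun _ _ hn1 => ?_)
    exact ha (isOfFinOrder_iff_zpow_eq_one.2 ⟨n, hn0, hn1⟩)
  exact zpow_zero _

theorem exists_not_isOfFinOrder_zpowers_inf_sigmaProduct_eq_bot :
    ∃ c : TorusPower.{u}, ¬ IsOfFinOrder c ∧ Subgroup.zpowers c ⊓ sigmaProduct.{u} = ⊥ :=
  ⟨fun _ => Circle.exp 1,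
    fun h => not_isOfFinOrder_circleExp_one (h.apply (Classical.arbitrary _)),
    zpowers_const_inf_sigmaProduct_eq_bot not_isOfFinOrder_circleExp_one⟩

/-! ### The Raikov completion of `Σ × ℤ` -/

/-- The group `ℤ`, written multiplicatively, with the topology of the upper sets. It is a
paratopological group that is not `T₁`, and its group coreflection is discrete. -/
def UpperInt : Type := Multiplicative ℤ

namespace UpperInt

/-- The integer `n` as an element of `UpperInt`. -/
def ofInt : ℤ ≃ UpperInt := Multiplicative.ofAdd

instance : CommGroup UpperInt := inferInstanceAs (CommGroup (Multiplicative ℤ))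
instance : LinearOrder UpperInt := inferInstanceAs (LinearOrder (Multiplicative ℤ))
instance : IsOrderedMonoid UpperInt := inferInstanceAs (IsOrderedMonoid (Multiplicative ℤ))
instance : TopologicalSpace UpperInt := Topology.upperSet UpperInt
instance : Topology.IsUpperSet UpperInt := ⟨rfl⟩
instance : ParatopologicalGroup UpperInt := .of_isUpperSet
instance : DiscreteTopology (Sharp UpperInt) := Sharp.discreteTopology_of_isUpperSet

end UpperInt

theorem hasBasis_nhds_prod_of_isUpperSet {X Y : Type*} [TopologicalSpace X] [TopologicalSpace Y]
    [Preorder Y] [Topology.IsUpperSet Y] (x : X) (y : Y) :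
    (𝓝 (x, y)).HasBasis (fun U => IsOpen U ∧ x ∈ U) fun U => U ×ˢ Set.Ici y := by
  rw [nhds_prod_eq, IsUpperSet.nhds_eq_principal_Ici y]
  exact ((nhds_basis_opens x).prod (hasBasis_principal _)).to_hasBasis
    (fun U hU => ⟨U.1, hU.1.symm, subset_rfl⟩)
    (fun U hU => ⟨(U, ()), ⟨hU.symm, trivial⟩, subset_rfl⟩)

namespace SigmaZ

/-- The group that contains `Σ × ℤ`, embedded by `toCompletion`, as a `♯`-dense subgroup. -/
abbrev Completion : Type u := TorusPower.{u} × UpperInt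

variable {c : TorusPower.{u}}

theorem torusPart_mul (g h : SigmaZ c) : (g * h).torusPart = g.torusPart * h.torusPart := rfl

theorem intPart_mul (g h : SigmaZ c) : (g * h).intPart = g.intPart + h.intPart := rfl

theorem ext {g h : SigmaZ c} (ht : g.torusPart = h.torusPart) (hn : g.intPart = h.intPart) :
    g = h :=
  Prod.ext (Subtype.ext ht) hn

/-- The element of `Σ × ℤ` with the given components. -/
def mk (c : TorusPower.{u}) (x : sigmaProduct.{u}) (n : ℤ) : SigmaZ c :=
  (x, Multiplicative.ofAdd n)

/-- The embedding of `Σ × ℤ` in its Raikov completion. The shear `x c⁻ⁿ` turns the sets `O_U`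
into the traces of the sets `U × {0, 1, 2, …}`. -/
noncomputable def toCompletion (c : TorusPower.{u}) : SigmaZ c →* Completion.{u} :=
  MonoidHom.mk' (fun g => (g.torusPart * c ^ (-g.intPart), UpperInt.ofInt g.intPart)) fun g h =>
    Prod.ext (by simp only [torusPart_mul, intPart_mul, neg_add, zpow_add, mul_mul_mul_comm,
      Prod.fst_mul]) rfl

theorem toCompletion_mk (x : sigmaProduct.{u}) (n : ℤ) :
    toCompletion c (mk c x n) = ((x : TorusPower.{u}) * c ^ (-n), UpperInt.ofInt n) := rfl

theorem toCompletion_mk_zero (x : sigmaProduct.{u}) : toCompletion c (mk c x 0) = (↑x, 1) := by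
  rw [toCompletion_mk, neg_zero, zpow_zero, mul_one]
  rfl

theorem injective_toCompletion : Function.Injective (toCompletion c) := by
  intro g h hgh
  obtain ⟨ht, hn⟩ := Prod.ext_iff.1 hgh
  have hn' : g.intPart = h.intPart := UpperInt.ofInt.injective hn
  refine ext (mul_right_cancel (b := c ^ (-g.intPart)) (ht.trans ?_)) hn'
  rw [hn']
  rfl

theorem injective_fst_toCompletion (hc : ¬ IsOfFinOrder c)
    (hcs : Subgroup.zpowers c ⊓ sigmaProduct.{u} = ⊥) :
    Function.Injective fun g : SigmaZ c => (toCompletion c g).1 := by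
  suffices h : Function.Injective
      ((MonoidHom.fst TorusPower.{u} UpperInt).comp (toCompletion c)) from h
  refine (injective_iff_map_eq_one _).2 fun g hg => ?_
  have htorus : g.torusPart = c ^ g.intPart := by
    have hg' : g.torusPart * c ^ (-g.intPart) = 1 := hg
    rwa [zpow_neg, mul_inv_eq_one] at hg'
  have hpow : c ^ g.intPart = 1 := by
    have hmem : c ^ g.intPart ∈ Subgroup.zpowers c ⊓ sigmaProduct.{u} :=
      ⟨⟨_, rfl⟩, htorus ▸ (Prod.fst g).2⟩
    rwa [hcs, Subgroup.mem_bot] at hmem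
  have hint : g.intPart = 0 := by
    by_contra hne
    exact hc (isOfFinOrder_iff_zpow_eq_one.2 ⟨_, hne, hpow⟩)
  exact ext (htorus.trans hpow) hint

theorem basicNhd_eq_preimage (U : Set TorusPower.{u}) :
    basicNhd c U = toCompletion c ⁻¹' (U ×ˢ Set.Ici 1) := by
  ext g
  have hshear (n : ℕ) (hn : g.intPart = n) :
      g.torusPart ∈ c ^ n • U ↔ g.torusPart * c ^ (-g.intPart) ∈ U := by
    rw [hn, Set.mem_smul_set_iff_inv_smul_mem, smul_eq_mul, mul_comm, zpow_neg, zpow_natCast]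
  constructor
  · rintro ⟨n, hgU, hn⟩
    exact ⟨(hshear n hn).1 hgU, show (0 : ℤ) ≤ g.intPart by lia⟩
  · rintro ⟨hgU, hn⟩
    obtain ⟨n, hn⟩ := Int.eq_ofNat_of_zero_le (show 0 ≤ g.intPart from hn)
    exact ⟨n, (hshear n hn).2 hgU, hn⟩

theorem smul_basicNhd_eq_preimage (g : SigmaZ c) (U : Set TorusPower.{u}) :
    g • basicNhd c U = toCompletion c ⁻¹' (toCompletion c g • (U ×ˢ Set.Ici 1)) := by
  ext h
  simp only [Set.mem_smul_set_iff_inv_smul_mem, basicNhd_eq_preimage, Set.mem_preimage,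
    smul_eq_mul, map_mul, map_inv]

theorem isInducing_toCompletion : IsInducing (toCompletion c) := by
  constructor
  refine TopologicalSpace.ext_iff.2 fun s => ?_
  let := TopologicalSpace.induced (toCompletion c) inferInstance
  refine Iff.trans (forall₂_congr fun g _ => ?_) isOpen_iff_mem_nhds.symm
  have hbasis := (hasBasis_nhds_smul
    (hasBasis_nhds_prod_of_isUpperSet (1 : TorusPower.{u}) (1 : UpperInt))
    (toCompletion c g)).comap (toCompletion c)
  rw [nhds_induced, hbasis.mem_iff]
  simp only [smul_basicNhd_eq_preimage, and_assoc]

theorem continuous_fst_toCompletion : Continuous fun g : SigmaZ c => (toCompletion c g).1 :=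
  continuous_fst.comp isInducing_toCompletion.continuous

theorem isEmbedding_toCompletion : IsEmbedding (toCompletion c) :=
  ⟨isInducing_toCompletion, injective_toCompletion⟩

instance instParatopologicalGroup : ParatopologicalGroup (SigmaZ c) :=
  .of_isEmbedding isEmbedding_toCompletion

theorem t2Space_of_zpowers_inf_sigmaProduct_eq_bot (hc : ¬ IsOfFinOrder c)
    (hcs : Subgroup.zpowers c ⊓ sigmaProduct.{u} = ⊥) : T2Space (SigmaZ c) :=
  .of_injective_continuous (injective_fst_toCompletion hc hcs) continuous_fst_toCompletion

theorem hasBasis_nhds_one :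
    (𝓝 (1 : SigmaZ c)).HasBasis (fun U : Set TorusPower.{u} => IsOpen U ∧ 1 ∈ U)
      (basicNhd c) := by
  rw [isInducing_toCompletion.nhds_eq_comap, map_one (toCompletion c)]
  simpa only [← basicNhd_eq_preimage, Prod.mk_one_one] using
    (hasBasis_nhds_prod_of_isUpperSet (1 : TorusPower.{u}) (1 : UpperInt)).comap (toCompletion c)

theorem isOpen_basicNhd {U : Set TorusPower.{u}} (hU : IsOpen U) : IsOpen (basicNhd c U) := by
  rw [basicNhd_eq_preimage]
  exact (hU.prod (IsUpperSet.isOpen_iff_isUpperSet.2 (isUpperSet_Ici _))).preimage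
    isInducing_toCompletion.continuous

theorem denseRange_sharpOf_toCompletion :
    DenseRange fun g : SigmaZ c => Sharp.of (toCompletion c g) := by
  rintro ⟨t, n⟩
  have hcont : Continuous fun x : TorusPower.{u} =>
      Sharp.of (x * c ^ (-UpperInt.ofInt.symm n), n) :=
    ((Sharp.prodHomeomorph _ _).symm.continuous.comp
      ((Sharp.continuousMulEquiv TorusPower.{u}).continuous_toFun.prodMk
        (continuous_const (y := Sharp.of n)))).comp (continuous_mul_const _)
  have hmem := map_mem_closure hcont (dense_sigmaProduct (t * c ^ UpperInt.ofInt.symm n))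
    (t := Set.range fun g => Sharp.of (toCompletion c g)) fun x hx => ⟨mk c ⟨x, hx⟩ _, rfl⟩
  rwa [mul_assoc, ← zpow_add, add_neg_cancel, zpow_zero, mul_one] at hmem

theorem sharpComplete_completion : SharpComplete Completion.{u} := by
  have := (Sharp.continuousMulEquiv TorusPower.{u}).toHomeomorph.compactSpace
  have := (Sharp.prodHomeomorph TorusPower.{u} UpperInt).isClosedEmbedding.weaklyLocallyCompactSpace
  exact .of_weaklyLocallyCompactSpace

theorem isRaikovCompletion_toCompletion : IsRaikovCompletion (toCompletion c) :=
  ⟨isEmbedding_toCompletion, denseRange_sharpOf_toCompletion, sharpComplete_completion⟩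

theorem not_t1Space_of_isRaikovCompletion {B : Type*} [Group B] [TopologicalSpace B]
    [ParatopologicalGroup B] {i : SigmaZ c →* B} (hi : IsRaikovCompletion i) : ¬ T1Space B := by
  intro _
  obtain ⟨e, -⟩ := isRaikovCompletion_toCompletion.exists_isomorphism hi
  have : T1Space Completion.{u} := e.symm.toHomeomorph.t1Space
  have hspec : ((1, UpperInt.ofInt 1) : Completion.{u}) ⤳ (1, UpperInt.ofInt 0) :=
    specializes_rfl.prod (IsUpperSet.specializes_iff_le.2 (zero_le_one (α := ℤ)))
  exact one_ne_zero (UpperInt.ofInt.injective (congrArg Prod.snd hspec.eq))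

/-! ### The subgroup `Σ × {0}` -/

/-- The topological isomorphism of the `Σ`-product onto the subgroup `Σ × {0}`. -/
noncomputable def sigmaSubgroupEquiv (c : TorusPower.{u}) :
    sigmaProduct.{u} ≃ₜ* sigmaSubgroup c where
  toFun x := ⟨mk c x 0, rfl⟩
  invFun g := Prod.fst g.1
  left_inv _ := rfl
  right_inv g := Subtype.ext (ext rfl g.2.symm)
  map_mul' _ _ := rfl
  continuous_toFun := by
    refine (isInducing_toCompletion.continuous_iff.2 ?_).subtype_mk _
    exact (continuous_subtype_val.prodMk continuous_const).congr fun x =>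
      (toCompletion_mk_zero x).symm
  continuous_invFun := by
    refine IsInducing.subtypeVal.continuous_iff.2
      ((continuous_fst_toCompletion.comp continuous_subtype_val).congr fun g => ?_)
    obtain ⟨x, hx⟩ : ∃ x, g = ⟨mk c x 0, rfl⟩ := ⟨g.1.1, Subtype.ext (ext rfl g.2)⟩
    rw [hx]
    exact congrArg Prod.fst (toCompletion_mk_zero x)

theorem isTopologicalGroup_sigmaSubgroup : IsTopologicalGroup (sigmaSubgroup c) :=
  (sigmaSubgroupEquiv c).symm.toHomeomorph.isInducing.topologicalGroup
    (sigmaSubgroupEquiv c).symm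

theorem seqCompactSpace_sigmaSubgroup : SeqCompactSpace (sigmaSubgroup c) where
  isSeqCompact_univ := by
    rw [← (sigmaSubgroupEquiv c).surjective.range_eq]
    exact .range (sigmaSubgroupEquiv c).continuous_toFun.seqContinuous

theorem omegaBounded_sigmaSubgroup : OmegaBounded (sigmaSubgroup c) :=
  omegaBounded_sigmaProduct.of_homeomorph (sigmaSubgroupEquiv c).toHomeomorph

theorem closure_sigmaSubgroup :
    closure (sigmaSubgroup c : Set (SigmaZ c)) = {g | g.intPart ≤ 0} := by
  refine Set.Subset.antisymm (closure_minimal (fun g hg => le_of_eq hg) ?_) fun g hg => ?_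
  · have hclosed : IsClosed (Prod.snd ⁻¹' Set.Iic 1 : Set Completion.{u}) :=
      (IsUpperSet.isClosed_iff_isLower.2 (isLowerSet_Iic _)).preimage continuous_snd
    exact hclosed.preimage isInducing_toCompletion.continuous
  · refine (mem_closure_iff_nhds_basis (hasBasis_nhds_smul hasBasis_nhds_one g)).2 ?_
    rintro U ⟨hU, h1U⟩
    obtain ⟨n, hn⟩ := Int.exists_eq_neg_ofNat hg
    obtain ⟨x, hx, hxs⟩ := dense_sigmaProduct.inter_open_nonempty (c ^ n • U) (hU.smul _)
      ⟨_, Set.smul_mem_smul_set h1U⟩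
    have hint : (g * mk c ⟨x, hxs⟩ n).intPart = 0 := by
      rw [intPart_mul, hn]
      exact neg_add_cancel _
    exact ⟨_, hint, Set.smul_mem_smul_set ⟨n, hx, rfl⟩⟩

theorem not_exists_coe_eq_closure_sigmaSubgroup : ¬ ∃ K : Subgroup (SigmaZ c),
    (K : Set (SigmaZ c)) = closure (sigmaSubgroup c : Set (SigmaZ c)) := by
  rintro ⟨K, hK⟩
  rw [closure_sigmaSubgroup] at hK
  have hmem (n : ℤ) : mk c 1 n ∈ K ↔ n ≤ 0 := Set.ext_iff.1 hK (mk c 1 n)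
  have hinv : mk c 1 1 = (mk c 1 (-1))⁻¹ := ext inv_one.symm rfl
  have h1 : mk c 1 1 ∈ K := hinv ▸ K.inv_mem ((hmem (-1)).2 (by decide))
  exact absurd ((hmem 1).1 h1) (by decide)

/-! ### The semicompletion of `Σ × ℤ` -/

section Semicompletion

variable {B : Type u} [Group B] [TopologicalSpace B] [ParatopologicalGroup B]
  {i : SigmaZ c →* B}

theorem eq_top_of_mem_semicompletionsIn (hi : IsRaikovCompletion i) {K : Subgroup B}
    (hK : K ∈ semicompletionsIn seqCompactHoms.{u} i) : K = ⊤ := by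
  obtain ⟨e, he⟩ := isRaikovCompletion_toCompletion.exists_isomorphism hi
  let h : sigmaProduct.{u} →ₜ* SigmaZ c :=
    ⟨(sigmaSubgroup c).subtype.comp (sigmaSubgroupEquiv c).toMonoidHom,
      continuous_subtype_val.comp (sigmaSubgroupEquiv c).continuous_toFun⟩
  let F : TorusPower.{u} →ₜ* B :=
    ⟨e.toMonoidHom.comp (MonoidHom.inl TorusPower.{u} UpperInt),
      e.continuous_toFun.comp (continuous_id.prodMk continuous_const)⟩
  have hF (x : sigmaProduct.{u}) : F (sigmaProduct.subtype x) = i (h x) :=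
    (congrArg e (toCompletion_mk_zero x).symm).trans (he _)
  have hFK : F.toMonoidHom.range ≤ K := range_le_of_mem_semicompletionsIn hK
    isRaikovCompletion_subtype_sigmaProduct
    ⟨inferInstance, inferInstance, inferInstance, inferInstance⟩ hF
  refine (Subgroup.eq_top_iff' K).2 fun b => ?_
  obtain ⟨⟨t, n⟩, rfl⟩ := e.surjective b
  obtain ⟨n, rfl⟩ := UpperInt.ofInt.surjective n
  have hdecomp : ((t, UpperInt.ofInt n) : Completion.{u}) =
      (t * c ^ n, 1) * toCompletion c (mk c 1 n) := by
    rw [toCompletion_mk, Prod.mk_mul_mk, one_mul, OneMemClass.coe_one, one_mul, mul_assoc,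
      ← zpow_add, add_neg_cancel, zpow_zero, mul_one]
  rw [hdecomp, map_mul, he]
  exact K.mul_mem (hFK ⟨_, rfl⟩) (hK.1 _)

theorem semicompletionsIn_seqCompactHoms_eq_singleton_top (hi : IsRaikovCompletion i) :
    semicompletionsIn seqCompactHoms.{u} i = {⊤} :=
  Set.eq_singleton_iff_unique_mem.2
    ⟨top_mem_semicompletionsIn hi, fun _ => eq_top_of_mem_semicompletionsIn hi⟩

theorem semicompletion_seqCompactHoms_eq_top (hi : IsRaikovCompletion i) :
    semicompletion seqCompactHoms.{u} i = ⊤ := by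
  rw [semicompletion, semicompletionsIn_seqCompactHoms_eq_singleton_top hi, sInf_singleton]

theorem isLeast_semicompletion_seqCompactHoms (hi : IsRaikovCompletion i) :
    IsLeast (semicompletionsIn seqCompactHoms.{u} i) (semicompletion seqCompactHoms.{u} i) := by
  rw [semicompletion_seqCompactHoms_eq_top hi,
    semicompletionsIn_seqCompactHoms_eq_singleton_top hi]
  exact isLeast_singleton

theorem not_t1Space_semicompletion_seqCompactHoms (hi : IsRaikovCompletion i) :
    ¬ T1Space (semicompletion seqCompactHoms.{u} i) := by
  rw [semicompletion_seqCompactHoms_eq_top hi]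
  intro _
  exact not_t1Space_of_isRaikovCompletion hi (Homeomorph.Set.univ B).t1Space

end Semicompletion

end SigmaZ

theorem mainTheorem2 :
    -- there are parameters `c` of infinite order with `⟨c⟩ ∩ Σ = {1}`
    (∃ c : TorusPower.{u}, ¬ IsOfFinOrder c ∧ Subgroup.zpowers c ⊓ sigmaProduct.{u} = ⊥) ∧
    -- and for each of them `G = Σ × ℤ` has the following properties
    ∀ c : TorusPower.{u}, ¬ IsOfFinOrder c → Subgroup.zpowers c ⊓ sigmaProduct.{u} = ⊥ →
      -- `G` is a Hausdorff paratopological (abelian) group with the sets `O_U` as an open base at 1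
      (ParatopologicalGroup (SigmaZ c) ∧ T2Space (SigmaZ c) ∧
        (𝓝 (1 : SigmaZ c)).HasBasis (fun U : Set TorusPower.{u} => IsOpen U ∧ 1 ∈ U)
          (SigmaZ.basicNhd c) ∧
        ∀ U : Set TorusPower.{u}, IsOpen U → 1 ∈ U → IsOpen (SigmaZ.basicNhd c U)) ∧
      -- `G` has a Raikov completion
      (∃ (B : Type u) (_ : Group B) (_ : TopologicalSpace B) (_ : ParatopologicalGroup B)
        (i : SigmaZ c →* B), IsRaikovCompletion i) ∧
      -- the `C`-semicompletion of `G` is its whole Raikov completion and is not a `T₁`-space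
      (∀ (B : Type u) [Group B] [TopologicalSpace B] [ParatopologicalGroup B]
        (i : SigmaZ c →* B), IsRaikovCompletion i →
          IsLeast (semicompletionsIn seqCompactHoms.{u} i) (semicompletion seqCompactHoms.{u} i) ∧
          semicompletion seqCompactHoms.{u} i = ⊤ ∧
          ¬ T1Space (semicompletion seqCompactHoms.{u} i)) ∧
      -- `H = Σ × {0}` is an `ω`-bounded sequentially compact topological group
      (IsTopologicalGroup (SigmaZ.sigmaSubgroup c) ∧ SeqCompactSpace (SigmaZ.sigmaSubgroup c) ∧
        OmegaBounded (SigmaZ.sigmaSubgroup c)) ∧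
      -- the closure of `H` in `G` is `Σ × (-ω)`, which is not a subgroup of `G`
      closure (SigmaZ.sigmaSubgroup c : Set (SigmaZ c)) = {g | g.intPart ≤ 0} ∧
      ¬ ∃ K : Subgroup (SigmaZ c),
        (K : Set (SigmaZ c)) = closure (SigmaZ.sigmaSubgroup c : Set (SigmaZ c)) := by
  refine ⟨exists_not_isOfFinOrder_zpowers_inf_sigmaProduct_eq_bot, fun c hc hcs =>
    ⟨⟨?_, ?_, ?_, ?_⟩, ?_, ?_, ⟨?_, ?_, ?_⟩, ?_, ?_⟩⟩
  · exact SigmaZ.instParatopologicalGroup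
  · exact SigmaZ.t2Space_of_zpowers_inf_sigmaProduct_eq_bot hc hcs
  · exact SigmaZ.hasBasis_nhds_one
  · exact fun U hU _ => SigmaZ.isOpen_basicNhd hU
  · exact ⟨SigmaZ.Completion.{u}, inferInstance, inferInstance, inferInstance,
      SigmaZ.toCompletion c, SigmaZ.isRaikovCompletion_toCompletion⟩
  · intro B _ _ _ i hi
    exact ⟨SigmaZ.isLeast_semicompletion_seqCompactHoms hi,
      SigmaZ.semicompletion_seqCompactHoms_eq_top hi,
      SigmaZ.not_t1Space_semicompletion_seqCompactHoms hi⟩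
  · exact SigmaZ.isTopologicalGroup_sigmaSubgroup
  · exact SigmaZ.seqCompactSpace_sigmaSubgroup
  · exact SigmaZ.omegaBounded_sigmaSubgroup
  · exact SigmaZ.closure_sigmaSubgroup
  · exact SigmaZ.not_exists_coe_eq_closure_sigmaSubgroup
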